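/- For a bounded distributive lattice $L$ let $\operatorname{spec}L$ be the set of prime filters $\mathfrak p$ of $L$ ($\mathfrak p$ is a filter, $\bot\notin\mathfrak p$, and $a\vee b\in\mathfrak p$ implies $a\in\mathfrak p$ or $b\in\mathfrak p$), with the topology generated by the sets $a^\#=\{\mathfrak p\mid a\in\mathfrak p\}$, $a\in L$. The prime filter monad $\mathbb F_p=(F_p,e,m)$ on the category $\mathsf{Top}$ of topological spaces is given by $F_pX=\operatorname{spec}(\mathcal O X)$, where $\mathcal O X$ is the lattice of open subsets of $X$, by $F_pf(\mathfrak f)=\{B\in\mathcal O Y\mid f^{-1}(B)\in\mathfrak f\}$ for $f\colon X\to Y$ continuous, $e_X(x)=\{A\in\mathcal O X\mid x\in A\}$ and $m_X(\mathfrak F)=\{A\in\mathcal O X\mid A^\#\in\mathfrak F\}$. A topological space $X$ is called a split algebra for $\mathbb F_p$ if it carries an Eilenberg–Moore algebra structure $\alpha\colon F_pX\to X$ for which there is an algebra homomorphism $t\colon (X,\alpha)\to (F_pX,m_X)$ with $\alpha t=1_X$. (1) A topological space $X$ (in particular, a stably compact space $X$) is a split algebra for $\mathbb F_p$ if and only if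 $X$ is spectral and its lattice $\mathcal S X$ of compact open subsets is a frame. (2) (Pultr–Sichler) Consequently, frames are described inside Stone/Priestley duality as follows: for every bounded distributive lattice $L$, the lattice $L$ is a frame if and only if $\operatorname{spec}L$ is a split algebra for $\mathbb F_p$; and this holds if and only if, for every open subset $U$ of $\operatorname{spec}L$, the closure of $U$ in the patch topology (generated by the compact open sets and their complements) is open in $\operatorname{spec}L$. -/

import Mathlib

open CategoryTheory TopologicalSpace

universe u

section Lattices

/-- A partially ordered set is a frame: its order is the order of a complete lattice in which
finite infima distribute over arbitrary suprema. -/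
def IsFrameOrder (L : Type u) [inst : PartialOrder L] : Prop :=
  ∃ F : Order.Frame L, (F.toPartialOrder : PartialOrder L) = inst

/-- The points of the spectrum of a bounded distributive lattice: its prime filters, that is, the
filters whose complement is an ideal (so they are proper, and `a ⊔ b ∈ p` implies `a ∈ p` or
`b ∈ p`). -/
structure LatticeSpec (L : Type u) [DistribLattice L] [BoundedOrder L] : Type u where
  /-- the underlying filter -/
  filter : Order.PFilter L
  /-- the filter is prime -/
  isPrime : filter.IsPrime

namespace LatticeSpec

variable {L M : Type u} [DistribLattice L] [BoundedOrder L] [DistribLattice M] [BoundedOrder M]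

instance : SetLike (LatticeSpec L) L where
  coe p := p.filter
  coe_injective p q h := by
    cases p; cases q
    congr 1
    exact SetLike.coe_injective h

@[ext]
theorem ext {p q : LatticeSpec L} (h : ∀ a, a ∈ p ↔ a ∈ q) : p = q := SetLike.ext h

theorem top_mem (p : LatticeSpec L) : (⊤ : L) ∈ p := p.filter.top_mem

theorem inf_mem_iff (p : LatticeSpec L) {a b : L} : a ⊓ b ∈ p ↔ a ∈ p ∧ b ∈ p :=
  Order.PFilter.inf_mem_iff

theorem mem_of_le (p : LatticeSpec L) {a b : L} (h : a ≤ b) (ha : a ∈ p) : b ∈ p :=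
  p.filter.mem_of_le h ha

theorem bot_notMem (p : LatticeSpec L) : (⊥ : L) ∉ p := by
  obtain ⟨a, ha⟩ := p.isPrime.compl_ideal.Nonempty
  exact fun h => ha (p.mem_of_le bot_le h)

theorem sup_mem_iff (p : LatticeSpec L) {a b : L} : a ⊔ b ∈ p ↔ a ∈ p ∨ b ∈ p := by
  constructor
  · intro h
    by_contra! hab
    obtain ⟨c, hc, hac, hbc⟩ := p.isPrime.compl_ideal.Directed a hab.1 b hab.2
    exact hc (p.mem_of_le (sup_le hac hbc) h)
  · rintro (h | h)
    · exact p.mem_of_le le_sup_left h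
    · exact p.mem_of_le le_sup_right h

/-- A set of lattice elements that contains `⊤` and not `⊥`, and for which membership turns finite
infima into "and" and finite suprema into "or", is a prime filter. -/
def ofSet (s : Set L) (top : ⊤ ∈ s) (bot : ⊥ ∉ s) (inf : ∀ a b, a ⊓ b ∈ s ↔ a ∈ s ∧ b ∈ s)
    (sup : ∀ a b, a ⊔ b ∈ s ↔ a ∈ s ∨ b ∈ s) : LatticeSpec L where
  filter := Order.IsPFilter.toPFilter (F := s) <|
    Order.IsPFilter.of_def ⟨⊤, top⟩
      (fun a ha b hb => ⟨a ⊓ b, (inf a b).2 ⟨ha, hb⟩, inf_le_left, inf_le_right⟩)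
      (fun {a b} hab ha => ((inf a b).1 (by rwa [inf_eq_left.2 hab])).2)
  isPrime := ⟨{
    IsLowerSet := fun a b hba ha hb => ha (by
      have := (sup b a).2 (Or.inl hb)
      rwa [sup_eq_right.2 hba] at this)
    Nonempty := ⟨⊥, bot⟩
    Directed := fun a ha b hb =>
      ⟨a ⊔ b, fun h => ((sup a b).1 h).elim ha hb, le_sup_left, le_sup_right⟩ }⟩

@[simp]
theorem mem_ofSet {s : Set L} {top bot inf sup} {a : L} :
    a ∈ ofSet s top bot inf sup ↔ a ∈ s := Iff.rfl

/-- The topology of the spectrum is generated by the sets `a^# = {p | a ∈ p}`. -/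
instance : TopologicalSpace (LatticeSpec L) :=
  .generateFrom {s | ∃ a : L, s = {p : LatticeSpec L | a ∈ p}}

theorem isOpen_setOf_mem (a : L) : IsOpen {p : LatticeSpec L | a ∈ p} :=
  .basic _ ⟨a, rfl⟩

/-- The lattice homomorphism `a ↦ a^# = {p | a ∈ p}` into the lattice of open sets. -/
def basicOpen : BoundedLatticeHom L (Opens (LatticeSpec L)) where
  toFun a := ⟨{p | a ∈ p}, isOpen_setOf_mem a⟩
  map_sup' _ _ := Opens.ext (Set.ext fun p => p.sup_mem_iff)
  map_inf' _ _ := Opens.ext (Set.ext fun p => p.inf_mem_iff)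
  map_top' := Opens.ext (Set.ext fun p => iff_of_true p.top_mem trivial)
  map_bot' := Opens.ext (Set.ext fun p => iff_of_false p.bot_notMem id)

@[simp]
theorem mem_basicOpen {a : L} {p : LatticeSpec L} : p ∈ basicOpen a ↔ a ∈ p := Iff.rfl

/-- Inverse image of prime filters along a lattice homomorphism. -/
def comap (f : BoundedLatticeHom L M) (p : LatticeSpec M) : LatticeSpec L :=
  ofSet {a | f a ∈ p} (by simp [p.top_mem]) (by simp [p.bot_notMem])
    (by simp [p.inf_mem_iff]) (by simp [p.sup_mem_iff])

@[simp]
theorem mem_comap {f : BoundedLatticeHom L M} {p : LatticeSpec M} {a : L} :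
    a ∈ comap f p ↔ f a ∈ p := Iff.rfl

theorem continuous_comap (f : BoundedLatticeHom L M) : Continuous (comap f) := by
  refine continuous_generateFrom_iff.2 ?_
  rintro _ ⟨a, rfl⟩
  exact isOpen_setOf_mem (f a)

end LatticeSpec

end Lattices

section PrimeFilterMonad

/-- Inverse image of open sets under a continuous map. -/
def opensPreimage {X Y : TopCat.{u}} (f : X ⟶ Y) : BoundedLatticeHom (Opens Y) (Opens X) where
  toFun B := ⟨f ⁻¹' B, B.isOpen.preimage f.hom.continuous⟩
  map_sup' _ _ := rfl
  map_inf' _ _ := rfl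
  map_top' := rfl
  map_bot' := rfl

/-- The prime filter of the open neighbourhoods of a point. -/
def openNhdsFilter {X : Type u} [TopologicalSpace X] (x : X) : LatticeSpec (Opens X) :=
  LatticeSpec.ofSet {A | x ∈ A} trivial id (fun _ _ => Iff.rfl) (fun _ _ => Iff.rfl)

/-- The functor of the prime filter monad. It sends `X` to the space of prime filters of open
subsets of `X` with the topology generated by the sets `A^# = {p | A ∈ p}`, and `f : X ⟶ Y` to the
map `p ↦ {B | f ⁻¹' B ∈ p}`. -/
def primeFilterFunctor : TopCat.{u} ⥤ TopCat.{u} where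
  obj X := TopCat.of (LatticeSpec (Opens X))
  map f := TopCat.ofHom ⟨LatticeSpec.comap (opensPreimage f), LatticeSpec.continuous_comap _⟩
  map_id _ := rfl
  map_comp _ _ := rfl

/-- The prime filter monad on topological spaces. The unit sends a point to its filter of open
neighbourhoods; the multiplication sends `P` to `{A | A^# ∈ P}`. -/
def primeFilterMonad : Monad TopCat.{u} where
  toFunctor := primeFilterFunctor
  η :=
    { app := fun X => TopCat.ofHom ⟨openNhdsFilter, by
        refine continuous_generateFrom_iff.2 ?_
        rintro _ ⟨A, rfl⟩
        exact A.isOpen⟩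
      naturality := fun _ _ _ => rfl }
  μ :=
    { app := fun X => TopCat.ofHom
        ⟨LatticeSpec.comap LatticeSpec.basicOpen, LatticeSpec.continuous_comap _⟩
      naturality := fun _ _ _ => rfl }
  assoc _ := rfl
  left_unit _ := rfl
  right_unit _ := rfl

/-- An algebra `(X, α)` for a monad `T` is split if `α : T X ⟶ X` has a section that is a
homomorphism of algebras from `(X, α)` to the free algebra `T X`. -/
def IsSplitAlgebra {C : Type*} [Category C] {T : Monad C} (A : T.Algebra) : Prop :=
  ∃ t : A ⟶ T.free.obj A.A, t.f ≫ A.a = 𝟙 A.A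

/-- `X` is (the underlying space of) a split algebra for the prime filter monad. -/
def IsSplitPrimeFilterAlgebra (X : Type u) [TopologicalSpace X] : Prop :=
  ∃ A : primeFilterMonad.{u}.Algebra, A.A = TopCat.of X ∧ IsSplitAlgebra A

end PrimeFilterMonad

open Topology

/-! ### Frame orders. -/

section FrameOrder

/-! For a split algebra `(X, α)` with section `t`, the map `c U = t⁻¹(U^#)` is at once a lattice
endomorphism and a nucleus on the opens of `X`. Since `t` is an embedding, the sets `c U` form a
basis; since `c U = α((c U)^#)`, they are compact. Hence `X` is spectral, and its compact opens are
the fixed points of a nucleus on a frame, so they form a frame.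

Conversely, if the compact opens of a spectral `X` form a frame, each open `U` has a least compact
open superset `c U`. Distributivity makes `c` preserve finite meets (`exists_compactOpenHull`), so
`{U | x ∈ c U}` is a prime filter, and this defines the section.

The lattice form follows from `L ≅ CompactOpens (LatticeSpec L)`. For the patch criterion, the patch
closure of an open `U` is open exactly when it is some `a^#`; such an `a` is a distributive supremum
of the elements whose basic opens lie in `U`. -/

/-- Distributivity is phrased through common lower bounds, so that it depends on the order alone and
not on a choice of infimum operation. -/
theorem IsFrameOrder.exists_isLUB {L : Type u} [PartialOrder L] (h : IsFrameOrder L)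
    (s : Set L) : ∃ b, IsLUB s b ∧
      ∀ x c, (∀ a ∈ s, ∀ d ≤ x, d ≤ a → d ≤ c) → ∀ d ≤ x, d ≤ b → d ≤ c := by
  obtain ⟨F, rfl⟩ := h
  refine ⟨sSup s, isLUB_sSup s, fun x c h d hdx hd => ?_⟩
  refine (le_inf hdx hd).trans ?_
  rw [inf_sSup_eq]
  exact iSup₂_le fun a ha => h a ha _ inf_le_left inf_le_right

/-- An order with binary infima is a frame order iff all suprema exist and binary infima distribute
over them. -/
theorem isFrameOrder_iff_of_semilatticeInf {L : Type u} [SemilatticeInf L] :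
    IsFrameOrder L ↔ ∀ s : Set L, ∃ b, IsLUB s b ∧
      ∀ x c, (∀ a ∈ s, x ⊓ a ≤ c) → x ⊓ b ≤ c := by
  constructor
  · intro h s
    obtain ⟨b, hb, hd⟩ := h.exists_isLUB s
    exact ⟨b, hb, fun x c hx => hd x c (fun a ha d hdx hda => (le_inf hdx hda).trans (hx a ha)) _
      inf_le_left inf_le_right⟩
  · intro h
    choose sup hsup hdist using h
    let : SupSet L := ⟨sup⟩
    let C : CompleteLattice L := completeLatticeOfSup L hsup
    -- `completeLatticeOfSup` builds its own infimum, to be matched with the given one.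
    have hinf : ∀ a b : L, C.inf a b = a ⊓ b := fun a b =>
      le_antisymm (le_inf (C.inf_le_left a b) (C.inf_le_right a b))
        (C.le_inf _ _ _ inf_le_left inf_le_right)
    refine ⟨Order.Frame.ofMinimalAxioms ⟨fun a s => ?_⟩, rfl⟩
    refine (hinf a _).le.trans (hdist s a _ fun b hb => ?_)
    exact (hinf a b).ge.trans (le_iSup₂ (f := fun b (_ : b ∈ s) => C.inf a b) b hb)

theorem isFrameOrder_of_frame {L : Type u} [F : Order.Frame L] : IsFrameOrder L := ⟨F, rfl⟩

theorem IsFrameOrder.of_orderIso {L M : Type u} [SemilatticeInf L] [SemilatticeInf M]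
    (e : L ≃o M) (h : IsFrameOrder L) : IsFrameOrder M := by
  rw [isFrameOrder_iff_of_semilatticeInf] at h ⊢
  intro s
  obtain ⟨b, hb, hd⟩ := h (e ⁻¹' s)
  refine ⟨e b, ?_, fun x c hx => ?_⟩
  · have := e.isLUB_image'.2 hb
    rwa [e.surjective.image_preimage] at this
  · have := hd (e.symm x) (e.symm c) fun a ha => by
      rw [e.le_symm_apply, map_inf, e.apply_symm_apply]
      exact hx _ ha
    rwa [e.le_symm_apply, map_inf, e.apply_symm_apply] at this

end FrameOrder

/-! ### Compact opens and limits of prime filters. -/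

section CompactOpen

/-- If a homomorphism of sup-semilattices into the opens has a basis as its range, then every
compact open set is in its range. -/
theorem exists_eq_of_isCompact_of_isTopologicalBasis {X : Type*} [TopologicalSpace X] {L : Type*}
    [SemilatticeSup L] [OrderBot L] (b : SupBotHom L (Opens X))
    (hb : IsTopologicalBasis (Set.range fun a => (b a : Set X))) {K : Set X}
    (hK : IsCompact K) (hK' : IsOpen K) : ∃ a, (b a : Set X) = K := by
  obtain ⟨s, hs⟩ := eq_finite_iUnion_of_isTopologicalBasis_of_isCompact_open _ hb K hK hK'
  classical
  obtain ⟨hfin, rfl⟩ := hs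
  refine ⟨hfin.toFinset.sup id, ?_⟩
  rw [map_finset_sup]
  ext x
  simp

/-- In a sober space, a prime filter of opens determines a point with the same compact open
neighbourhoods. -/
theorem exists_forall_isCompact_mem_iff {X : Type u} [TopologicalSpace X] [CompactSpace X]
    [QuasiSober X] [QuasiSeparatedSpace X] [PrespectralSpace X] (p : LatticeSpec (Opens X)) :
    ∃ x : X, ∀ K : Opens X, IsCompact (K : Set X) → (x ∈ K ↔ K ∈ p) := by
  -- `C` will be the closure of the required point, which is obtained as its generic point.
  set C : Set X := {x | ∀ K : Opens X, IsCompact (K : Set X) → x ∈ K → K ∈ p} with hCdef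
  have hClosed : IsClosed C := by
    have : C = ⋂ K : {K : Opens X // IsCompact (K : Set X) ∧ K ∉ p}, ((K : Opens X) : Set X)ᶜ := by
      ext x
      simp only [hCdef, Set.mem_ofPred_eq, Set.mem_iInter, Subtype.forall, Set.mem_compl_iff,
        SetLike.mem_coe]
      exact ⟨fun h K hK hx => hK.2 (h K hK.1 hx),
        fun h K hK hx => by_contra fun hp => h K ⟨hK, hp⟩ hx⟩
    rw [this]
    exact isClosed_iInter fun K => K.1.isOpen.isClosed_compl
  have hmeet : ∀ K : Opens X, IsCompact (K : Set X) → K ∈ p → (C ∩ K).Nonempty := by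
    intro K hK hKp
    by_contra hne
    -- The compact opens outside `p` are directed because `p` is prime, so a single one would
    -- contain `K`.
    have hcov : (K : Set X) ⊆
        ⋃ J : {J : Opens X // IsCompact (J : Set X) ∧ J ∉ p}, ((J : Opens X) : Set X) := by
      intro x hx
      have hxC : x ∉ C := fun h => hne ⟨x, h, hx⟩
      simp only [hCdef, Set.mem_ofPred_eq, not_forall] at hxC
      obtain ⟨J, hJ, hxJ, hJp⟩ := hxC
      exact Set.mem_iUnion.2 ⟨⟨J, hJ, hJp⟩, hxJ⟩
    have : Nonempty {J : Opens X // IsCompact (J : Set X) ∧ J ∉ p} :=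
      ⟨⊥, by simp, p.bot_notMem⟩
    obtain ⟨J, hJ⟩ := hK.elim_directed_cover _ (fun J => J.1.isOpen) hcov
      (fun J J' => ⟨⟨J.1 ⊔ J'.1, J.2.1.union J'.2.1,
        fun h => (p.sup_mem_iff.1 h).elim J.2.2 J'.2.2⟩,
        Set.subset_union_left, Set.subset_union_right⟩)
    exact J.2.2 (p.mem_of_le hJ hKp)
  have hIrr : IsIrreducible C := by
    refine ⟨?_, ?_⟩
    · obtain ⟨x, hx, -⟩ := hmeet ⊤ isCompact_univ p.top_mem
      exact ⟨x, hx⟩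
    · rintro U V hU hV ⟨x, hxC, hxU⟩ ⟨y, hyC, hyV⟩
      obtain ⟨K, ⟨hKo, hKc⟩, hxK, hKU⟩ :=
        PrespectralSpace.isTopologicalBasis.exists_subset_of_mem_open hxU hU
      obtain ⟨J, ⟨hJo, hJc⟩, hyJ, hJV⟩ :=
        PrespectralSpace.isTopologicalBasis.exists_subset_of_mem_open hyV hV
      obtain ⟨z, hzC, hzK, hzJ⟩ := hmeet (⟨K, hKo⟩ ⊓ ⟨J, hJo⟩) (hKc.inter_of_isOpen hJc hKo hJo)
        (p.inf_mem_iff.2 ⟨hxC _ hKc hxK, hyC _ hJc hyJ⟩)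
      exact ⟨z, hzC, hKU hzK, hJV hzJ⟩
  obtain ⟨x, hx⟩ := QuasiSober.sober hIrr hClosed
  refine ⟨x, fun K hK => ⟨fun hxK => hx.mem K hK hxK, fun hKp => ?_⟩⟩
  exact (hx.mem_open_set_iff K.isOpen).2 (hmeet K hK hKp)

end CompactOpen

/-! ### Spectra of distributive lattices and the patch topology. -/

namespace LatticeSpec

section Spectral

variable {L : Type u} [DistribLattice L] [BoundedOrder L]

/-- An element outside an ideal is contained in a prime filter disjoint from the ideal. -/
theorem exists_mem_of_notMem_ideal {a : L} {I : Order.Ideal L} (ha : a ∉ I) :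
    ∃ p : LatticeSpec L, a ∈ p ∧ ∀ b ∈ I, b ∉ p := by
  have hd : Disjoint (Order.PFilter.principal a : Set L) (I : Set L) :=
    Set.disjoint_left.2 fun b hb hbI => ha (I.lower (Order.PFilter.mem_principal.1 hb) hbI)
  obtain ⟨J, hJ, hIJ, hdis⟩ := DistribLattice.prime_ideal_of_disjoint_filter_ideal hd
  have haJ : a ∉ J := fun h =>
    Set.disjoint_left.1 hdis (Order.PFilter.mem_principal.2 le_rfl) h
  refine ⟨ofSet {x | x ∉ J} ?_ ?_ ?_ ?_, haJ, fun b hb h => h (hIJ hb)⟩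
  · exact fun h => haJ (J.lower le_top h)
  · exact fun h => h J.bot_mem
  · intro x y
    have : x ⊓ y ∈ J ↔ x ∈ J ∨ y ∈ J :=
      ⟨fun h => hJ.mem_or_mem h,
        fun h => h.elim (J.lower inf_le_left) (J.lower inf_le_right)⟩
    simp [this]
  · intro x y
    simp only [Set.mem_ofPred_eq, Order.Ideal.sup_mem_iff]
    tauto

theorem basicOpen_le_basicOpen {a b : L} :
    (basicOpen a : Opens (LatticeSpec L)) ≤ basicOpen b ↔ a ≤ b := by
  refine ⟨fun h => ?_, fun h p hp => p.mem_of_le h hp⟩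
  by_contra hab
  obtain ⟨p, hap, hp⟩ := exists_mem_of_notMem_ideal (I := Order.Ideal.principal b)
    (fun h => hab (Order.Ideal.mem_principal.1 h))
  exact hp b (Order.Ideal.mem_principal.2 le_rfl) (h hap)

theorem isTopologicalBasis_basicOpen :
    IsTopologicalBasis (Set.range fun a : L => (basicOpen a : Set (LatticeSpec L))) where
  exists_subset_inter := by
    rintro _ ⟨a, rfl⟩ _ ⟨b, rfl⟩ p ⟨ha, hb⟩
    exact ⟨_, ⟨a ⊓ b, rfl⟩, p.inf_mem_iff.2 ⟨ha, hb⟩, fun q hq => q.inf_mem_iff.1 hq⟩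
  sUnion_eq := Set.eq_univ_of_forall fun p => ⟨_, ⟨⊤, rfl⟩, p.top_mem⟩
  eq_generateFrom := by
    refine congrArg TopologicalSpace.generateFrom (Set.ext fun s => ?_)
    exact ⟨fun ⟨a, ha⟩ => ⟨a, ha.symm⟩, fun ⟨a, ha⟩ => ⟨a, ha.symm⟩⟩

theorem exists_basicOpen_subset {U : Set (LatticeSpec L)} (hU : IsOpen U) {p : LatticeSpec L}
    (hp : p ∈ U) : ∃ a ∈ p, (basicOpen a : Set (LatticeSpec L)) ⊆ U := by
  obtain ⟨_, ⟨a, rfl⟩, ha, hs⟩ := isTopologicalBasis_basicOpen.exists_subset_of_mem_open hp hU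
  exact ⟨a, ha, hs⟩

theorem isCompact_basicOpen (a : L) : IsCompact (basicOpen a : Set (LatticeSpec L)) := by
  refine isCompact_of_finite_subcover fun {ι} U hU hcov => ?_
  classical
  -- The ideal of elements whose basic open has a finite subcover; a prime filter that contains `a`
  -- and avoids `I` would lie in no `U i`.
  let I : Order.Ideal L := Order.IsIdeal.toIdeal
    (I := {b : L | ∃ t : Finset ι, (basicOpen b : Set (LatticeSpec L)) ⊆ ⋃ i ∈ t, U i})
    { IsLowerSet := fun b c hcb ⟨t, ht⟩ => ⟨t, fun _ hp => ht (basicOpen_le_basicOpen.2 hcb hp)⟩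
      Nonempty := ⟨⊥, ∅, fun p hp => (p.bot_notMem hp).elim⟩
      Directed := fun b ⟨t, ht⟩ c ⟨t', ht'⟩ => ⟨b ⊔ c, ⟨t ∪ t', fun p hp => by
        rw [Finset.set_biUnion_union]
        exact (p.sup_mem_iff.1 hp).imp (fun h => ht h) (fun h => ht' h)⟩,
        le_sup_left, le_sup_right⟩ }
  suffices h : a ∈ I from h
  by_contra h
  obtain ⟨p, hap, hp⟩ := exists_mem_of_notMem_ideal h
  obtain ⟨i, hi⟩ := Set.mem_iUnion.1 (hcov hap)
  obtain ⟨b, hb, hbU⟩ := exists_basicOpen_subset (hU i) hi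
  exact hp b ⟨{i}, by simpa using hbU⟩ hb

instance : SpectralSpace (LatticeSpec L) where
  t0 p q h := by
    refine LatticeSpec.ext fun a => ?_
    exact h.mem_open_iff (isOpen_setOf_mem a)
  isCompact_univ := by
    have := isCompact_basicOpen (⊤ : L)
    rwa [map_top] at this
  sober := by
    intro C hirr hC
    -- The generic point of `C` must contain `a` exactly when `a^#` meets `C`.
    refine ⟨ofSet {a | (C ∩ basicOpen a).Nonempty} ?_ ?_ ?_ ?_, ?_⟩
    · obtain ⟨p, hp⟩ := hirr.1
      exact ⟨p, hp, p.top_mem⟩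
    · rintro ⟨p, -, hp⟩
      exact p.bot_notMem hp
    · intro a b
      constructor
      · rintro ⟨p, hp, hab⟩
        exact ⟨⟨p, hp, (p.inf_mem_iff.1 hab).1⟩, ⟨p, hp, (p.inf_mem_iff.1 hab).2⟩⟩
      · rintro ⟨ha, hb⟩
        obtain ⟨p, hp, hpa, hpb⟩ :=
          hirr.2 _ _ (isOpen_setOf_mem a) (isOpen_setOf_mem b) ha hb
        exact ⟨p, hp, p.inf_mem_iff.2 ⟨hpa, hpb⟩⟩
    · intro a b
      constructor
      · rintro ⟨p, hp, hab⟩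
        exact (p.sup_mem_iff.1 hab).imp (fun h => ⟨p, hp, h⟩) (fun h => ⟨p, hp, h⟩)
      · rintro (⟨p, hp, h⟩ | ⟨p, hp, h⟩)
        · exact ⟨p, hp, p.sup_mem_iff.2 (Or.inl h)⟩
        · exact ⟨p, hp, p.sup_mem_iff.2 (Or.inr h)⟩
    · refine Set.Subset.antisymm (closure_minimal (Set.singleton_subset_iff.2 ?_) hC) ?_
      · by_contra h
        obtain ⟨a, ⟨p, hp, hpa⟩, ha⟩ := exists_basicOpen_subset hC.isOpen_compl h
        exact ha hpa hp
      · intro p hp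
        refine mem_closure_iff.2 fun U hU hpU => ?_
        obtain ⟨a, ha, haU⟩ := exists_basicOpen_subset hU hpU
        exact ⟨_, haU (show (C ∩ basicOpen a).Nonempty from ⟨p, hp, ha⟩), rfl⟩
  toQuasiSeparatedSpace := .of_isTopologicalBasis isTopologicalBasis_basicOpen fun a b => by
    have := isCompact_basicOpen (a ⊓ b)
    rwa [map_inf] at this
  toPrespectralSpace := .of_isTopologicalBasis' isTopologicalBasis_basicOpen isCompact_basicOpen

theorem exists_basicOpen_eq {K : Set (LatticeSpec L)} (hK : IsCompact K) (hK' : IsOpen K) :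
    ∃ a : L, (basicOpen a : Set (LatticeSpec L)) = K :=
  exists_eq_of_isCompact_of_isTopologicalBasis
    ⟨⟨basicOpen, map_sup basicOpen⟩, map_bot basicOpen⟩ isTopologicalBasis_basicOpen hK hK'

/-- A bounded distributive lattice is isomorphic to the compact opens of its spectrum. -/
noncomputable def orderIsoCompactOpens (L : Type u) [DistribLattice L] [BoundedOrder L] :
    L ≃o CompactOpens (LatticeSpec L) :=
  RelIso.ofSurjective (OrderEmbedding.ofMapLEIff
    (fun a => (⟨⟨basicOpen a, isCompact_basicOpen a⟩, (basicOpen a).isOpen⟩ :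
      CompactOpens (LatticeSpec L))) fun _ _ => basicOpen_le_basicOpen) fun K => by
    obtain ⟨a, ha⟩ := exists_basicOpen_eq K.isCompact K.isOpen
    exact ⟨a, CompactOpens.ext ha⟩

theorem isOpen_constructibleTopology_basicOpen (a : L) :
    IsOpen[constructibleTopology (LatticeSpec L)] (basicOpen a : Set (LatticeSpec L)) :=
  (isCompact_basicOpen a).isOpen_constructibleTopology_of_isOpen (basicOpen a).isOpen

theorem isClosed_constructibleTopology_basicOpen (a : L) :
    IsClosed[constructibleTopology (LatticeSpec L)] (basicOpen a : Set (LatticeSpec L)) := by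
  refine (@isOpen_compl_iff _ _ (constructibleTopology (LatticeSpec L))).1
    (IsCompact.isOpen_constructibleTopology_of_isClosed ?_ (isOpen_setOf_mem a).isClosed_compl)
  rw [compl_compl]
  exact isCompact_basicOpen a

/-- The sets of prime filters that contain `b` and omit `c` are a basis of the patch topology. -/
theorem exists_mem_notMem_of_isOpen_constructibleTopology {O : Set (LatticeSpec L)}
    (hO : IsOpen[constructibleTopology (LatticeSpec L)] O) {p : LatticeSpec L} (hp : p ∈ O) :
    ∃ b c : L, b ∈ p ∧ c ∉ p ∧ ∀ q : LatticeSpec L, b ∈ q → c ∉ q → q ∈ O := by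
  induction hO with
  | basic s hs =>
    rcases hs with ⟨ho, hc⟩ | ⟨ho, hc⟩
    · obtain ⟨a, rfl⟩ := exists_basicOpen_eq hc ho
      exact ⟨a, ⊥, hp, p.bot_notMem, fun q hq _ => hq⟩
    · obtain ⟨a, ha⟩ := exists_basicOpen_eq hc ho.isOpen_compl
      have hs : ∀ q : LatticeSpec L, a ∉ q ↔ q ∈ s := fun q => by
        rw [← mem_basicOpen, ← SetLike.mem_coe, ha, Set.notMem_compl_iff]
      exact ⟨⊤, a, p.top_mem, (hs p).2 hp, fun q _ hq => (hs q).1 hq⟩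
  | univ => exact ⟨⊤, ⊥, p.top_mem, p.bot_notMem, fun _ _ _ => trivial⟩
  | inter s t _ _ ihs iht =>
    obtain ⟨b, c, hb, hc, h⟩ := ihs hp.1
    obtain ⟨b', c', hb', hc', h'⟩ := iht hp.2
    refine ⟨b ⊓ b', c ⊔ c', p.inf_mem_iff.2 ⟨hb, hb'⟩,
      fun hh => (p.sup_mem_iff.1 hh).elim hc hc', fun q hq hq' => ?_⟩
    rw [inf_mem_iff] at hq
    rw [sup_mem_iff, not_or] at hq'
    exact ⟨h q hq.1 hq'.1, h' q hq.2 hq'.2⟩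
  | sUnion S _ ih =>
    obtain ⟨s, hs, hps⟩ := hp
    obtain ⟨b, c, hb, hc, h⟩ := ih s hs hps
    exact ⟨b, c, hb, hc, fun q hq hq' => ⟨s, hs, h q hq hq'⟩⟩

/-- A patch closed subset of the spectrum is compact. -/
theorem isCompact_of_isClosed_constructibleTopology {V : Set (LatticeSpec L)}
    (hV : IsClosed[constructibleTopology (LatticeSpec L)] V) : IsCompact V := by
  let f : WithConstructibleTopology (LatticeSpec L) → LatticeSpec L := WithTopology.ofTopology
  have hf : Continuous f := by
    refine continuous_generateFrom_iff.2 ?_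
    rintro _ ⟨a, rfl⟩
    exact isOpen_constructibleTopology_basicOpen a
  have hV' : IsClosed (f ⁻¹' V) := WithConstructibleTopology.isClosed_iff.2 hV
  have := hV'.isCompact.image hf
  rwa [Set.image_preimage_eq V (WithTopology.ofTopology_surjective _)] at this

/-- A bounded distributive lattice is a frame iff patch closures of opens of its spectrum are
open. -/
theorem isFrameOrder_iff_isOpen_closure :
    IsFrameOrder L ↔ ∀ U : Set (LatticeSpec L), IsOpen U →
      IsOpen (@closure _ (constructibleTopology (LatticeSpec L)) U) := by
  rw [isFrameOrder_iff_of_semilatticeInf]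
  constructor
  · intro h U hU
    obtain ⟨a, hlub, hdist⟩ := h {b | (basicOpen b : Set (LatticeSpec L)) ⊆ U}
    suffices hcl : @closure _ (constructibleTopology (LatticeSpec L)) U = basicOpen a by
      rw [hcl]
      exact (basicOpen a).isOpen
    refine Set.Subset.antisymm ?_ ?_
    · refine @closure_minimal _ (constructibleTopology (LatticeSpec L)) _ _ ?_
        (isClosed_constructibleTopology_basicOpen a)
      intro p hp
      obtain ⟨b, hb, hbU⟩ := exists_basicOpen_subset hU hp
      exact p.mem_of_le (hlub.1 hbU) hb
    · intro p hp
      refine (@mem_closure_iff _ (constructibleTopology (LatticeSpec L)) _ _).2 fun O hO hpO => ?_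
      obtain ⟨b, c, hb, hc, hbc⟩ := exists_mem_notMem_of_isOpen_constructibleTopology hO hpO
      -- If the patch neighbourhood `b^# \ c^#` misses `U`, then `b ⊓ d ≤ c` whenever `d^# ⊆ U`,
      -- hence `b ⊓ a ≤ c` by distributivity.
      by_contra hne
      refine hc (p.mem_of_le (hdist b c fun d hd => ?_) (p.inf_mem_iff.2 ⟨hb, hp⟩))
      refine basicOpen_le_basicOpen.1 fun q hq => ?_
      by_contra hcq
      have hq' := q.inf_mem_iff.1 hq
      exact hne ⟨q, hbc q hq'.1 hcq, hd hq'.2⟩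
  · intro h s
    set U : Set (LatticeSpec L) := ⋃ a ∈ s, basicOpen a
    have hUo : IsOpen U := isOpen_biUnion fun a _ => (basicOpen a).isOpen
    have hclosed : IsClosed[constructibleTopology (LatticeSpec L)]
        (@closure _ (constructibleTopology (LatticeSpec L)) U) :=
      @isClosed_closure _ (constructibleTopology (LatticeSpec L)) U
    obtain ⟨b, hb⟩ := exists_basicOpen_eq
      (isCompact_of_isClosed_constructibleTopology hclosed) (h U hUo)
    have hUb : U ⊆ basicOpen b := by
      rw [hb]
      exact @subset_closure _ (constructibleTopology (LatticeSpec L)) U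
    have hmin : ∀ V, IsClosed[constructibleTopology (LatticeSpec L)] V → U ⊆ V →
        (basicOpen b : Set (LatticeSpec L)) ⊆ V := by
      intro V hV hUV
      rw [hb]
      exact @closure_minimal _ (constructibleTopology (LatticeSpec L)) _ _ hUV hV
    have hle : ∀ a ∈ s, a ≤ b := fun a ha => basicOpen_le_basicOpen.1 fun p hp =>
      hUb (Set.mem_biUnion ha hp)
    have hdist : ∀ x c, (∀ a ∈ s, x ⊓ a ≤ c) → x ⊓ b ≤ c := by
      intro x c hx
      -- This patch closed set plays the role of the implication `x ⇨ c`; it contains `U`, hence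
      -- also its patch closure `b^#`.
      have hV : IsClosed[constructibleTopology (LatticeSpec L)]
          ((basicOpen x : Set (LatticeSpec L))ᶜ ∪ basicOpen c) := by
        refine @IsClosed.union _ _ _ (constructibleTopology (LatticeSpec L)) ?_
          (isClosed_constructibleTopology_basicOpen c)
        rw [@isClosed_compl_iff _ (constructibleTopology (LatticeSpec L))]
        exact isOpen_constructibleTopology_basicOpen x
      have hsub := hmin _ hV (Set.iUnion₂_subset fun a ha p hp => by
        by_cases hxp : x ∈ p
        · exact Or.inr (p.mem_of_le (hx a ha) (p.inf_mem_iff.2 ⟨hxp, hp⟩))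
        · exact Or.inl hxp)
      refine basicOpen_le_basicOpen.1 fun p hp => ?_
      have hp' := p.inf_mem_iff.1 hp
      exact (hsub hp'.2).resolve_left fun hn => hn hp'.1
    refine ⟨b, ⟨hle, fun c hc => ?_⟩, hdist⟩
    simpa using hdist ⊤ c fun a ha => inf_le_right.trans (hc ha)

end Spectral

end LatticeSpec

/-! ### From split algebras to spectral spaces with a frame of compact opens. -/

section SplitAlgebra

open LatticeSpec

variable {X : Type u} [TopologicalSpace X]

/-- The lattice endomorphism `U ↦ t ⁻¹' U^#` of the opens of `X` given by a continuous map `t` from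
`X` to the space of prime filters of opens. -/
def opensEndo (t : C(X, LatticeSpec (Opens X))) : BoundedLatticeHom (Opens X) (Opens X) :=
  (opensPreimage (X := TopCat.of X) (Y := TopCat.of (LatticeSpec (Opens X)))
    (TopCat.ofHom t)).comp basicOpen

@[simp]
theorem mem_opensEndo {t : C(X, LatticeSpec (Opens X))} {U : Opens X} {x : X} :
    x ∈ opensEndo t U ↔ U ∈ t x := Iff.rfl

variable {α : C(LatticeSpec (Opens X), X)} {t : C(X, LatticeSpec (Opens X))}

/-- The structure map of an algebra sends a prime filter to one of its limits. -/
theorem mem_of_apply_mem (hα : ∀ x, α (openNhdsFilter x) = x) {p : LatticeSpec (Opens X)}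
    {U : Opens X} (h : α p ∈ U) : U ∈ p := by
  obtain ⟨V, hV, hVU⟩ := exists_basicOpen_subset (U.isOpen.preimage α.continuous) h
  refine p.mem_of_le (fun x hx => ?_) hV
  have : α (openNhdsFilter x) ∈ U := hVU (show V ∈ openNhdsFilter x from hx)
  rwa [hα] at this

/-- The nucleus on the opens of a split algebra. -/
def splitNucleus (hα : ∀ x, α (openNhdsFilter x) = x) (hαt : ∀ x, α (t x) = x)
    (ht : ∀ p U, U ∈ t (α p) ↔ opensEndo t U ∈ p) : Nucleus (Opens X) where
  toFun := opensEndo t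
  map_inf' := map_inf _
  -- The homomorphism law at the prime filter `t x`, where `α (t x) = x`.
  idempotent' U x hx := by
    have := (ht (t x) U).2 hx
    rwa [hαt] at this
  le_apply' U x hx := mem_of_apply_mem hα (p := t x) (by rwa [hαt])

theorem isTopologicalBasis_opensEndo (hαt : ∀ x, α (t x) = x) :
    IsTopologicalBasis (Set.range fun U => (opensEndo t U : Set X)) := by
  have hind : IsInducing t := (Function.LeftInverse.isEmbedding hαt α.continuous t.continuous).1
  have := isTopologicalBasis_basicOpen.isInducing hind
  rwa [← Set.range_comp] at this

/-- By idempotence, the set is the image under `α` of a compact basic open. -/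
theorem isCompact_opensEndo (hα : ∀ x, α (openNhdsFilter x) = x) (hαt : ∀ x, α (t x) = x)
    (ht : ∀ p U, U ∈ t (α p) ↔ opensEndo t U ∈ p) (U : Opens X) :
    IsCompact (opensEndo t U : Set X) := by
  have hidem : opensEndo t (opensEndo t U) = opensEndo t U :=
    (splitNucleus hα hαt ht).idempotent U
  suffices h : (opensEndo t U : Set X) = α '' (basicOpen (opensEndo t U)) by
    rw [h]
    exact (isCompact_basicOpen _).image α.continuous
  refine Set.Subset.antisymm (fun x hx => ⟨t x, ?_, hαt x⟩) ?_
  · rw [← hidem] at hx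
    exact hx
  · rintro _ ⟨p, hp, rfl⟩
    exact (ht p U).2 hp

theorem spectralSpace_of_split (hα : ∀ x, α (openNhdsFilter x) = x) (hαt : ∀ x, α (t x) = x)
    (ht : ∀ p U, U ∈ t (α p) ↔ opensEndo t U ∈ p) : SpectralSpace X where
  toT0Space := (Function.LeftInverse.isEmbedding hαt α.continuous t.continuous).t0Space
  isCompact_univ := by
    have := isCompact_opensEndo hα hαt ht ⊤
    rwa [map_top] at this
  sober := by
    intro C hirr hC
    -- Sobriety passes to retracts: `α` carries a generic point of the closure of `t '' C` to one of
    -- `C`.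
    obtain ⟨p, hp⟩ := QuasiSober.sober (hirr.image t t.continuous.continuousOn).closure
      isClosed_closure
    refine ⟨α p, Set.Subset.antisymm (closure_minimal (Set.singleton_subset_iff.2 ?_) hC) ?_⟩
    · have h := image_closure_subset_closure_image α.continuous (Set.mem_image_of_mem α hp.mem)
      simpa [Set.image_image, hαt, hC.closure_eq] using h
    · intro x hx
      have h : t x ∈ closure {p} := by
        rw [hp.def]
        exact subset_closure (Set.mem_image_of_mem t hx)
      have := image_closure_subset_closure_image α.continuous (Set.mem_image_of_mem α h)
      simpa [hαt] using this
  toQuasiSeparatedSpace := .of_isTopologicalBasis (isTopologicalBasis_opensEndo hαt) fun U V => by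
    have := isCompact_opensEndo hα hαt ht (U ⊓ V)
    rwa [map_inf] at this
  toPrespectralSpace :=
    .of_isTopologicalBasis' (isTopologicalBasis_opensEndo hαt) (isCompact_opensEndo hα hαt ht)

/-- The compact opens of a split algebra are the opens fixed by its nucleus. -/
noncomputable def rangeSplitNucleusOrderIso (hα : ∀ x, α (openNhdsFilter x) = x)
    (hαt : ∀ x, α (t x) = x) (ht : ∀ p U, U ∈ t (α p) ↔ opensEndo t U ∈ p) :
    Set.range (splitNucleus hα hαt ht) ≃o CompactOpens X :=
  RelIso.ofSurjective (OrderEmbedding.ofMapLEIff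
    (fun U => (⟨⟨U.1, by
      obtain ⟨_, U, rfl⟩ := U
      exact isCompact_opensEndo hα hαt ht U⟩, U.1.isOpen⟩ : CompactOpens X))
      fun _ _ => Iff.rfl) fun K => by
    obtain ⟨U, hU⟩ := exists_eq_of_isCompact_of_isTopologicalBasis
      ⟨⟨opensEndo t, map_sup (opensEndo t)⟩, map_bot (opensEndo t)⟩
      (isTopologicalBasis_opensEndo hαt) K.isCompact K.isOpen
    exact ⟨⟨_, U, rfl⟩, CompactOpens.ext hU⟩

theorem isFrameOrder_compactOpens_of_split (hα : ∀ x, α (openNhdsFilter x) = x)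
    (hαt : ∀ x, α (t x) = x) (ht : ∀ p U, U ∈ t (α p) ↔ opensEndo t U ∈ p) :
    IsFrameOrder (CompactOpens X) := by
  have := spectralSpace_of_split hα hαt ht
  exact isFrameOrder_of_frame.of_orderIso (rangeSplitNucleusOrderIso hα hαt ht)

theorem IsSplitPrimeFilterAlgebra.spectralSpace_and_isFrameOrder
    (h : IsSplitPrimeFilterAlgebra X) : SpectralSpace X ∧ IsFrameOrder (CompactOpens X) := by
  obtain ⟨⟨A, a, hunit, hassoc⟩, hA, s, hs⟩ := h
  dsimp only at hA
  subst hA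
  have hα : ∀ x, a.hom (openNhdsFilter x) = x := fun x => ConcreteCategory.congr_hom hunit x
  have hαt : ∀ x, a.hom (s.f.hom x) = x := fun x => ConcreteCategory.congr_hom hs x
  let α : C(LatticeSpec (Opens X), X) := a.hom
  let t : C(X, LatticeSpec (Opens X)) := s.f.hom
  have ht : ∀ p U, U ∈ t (α p) ↔ opensEndo t U ∈ p := fun p U =>
    iff_of_eq (congrArg (fun q : LatticeSpec (Opens X) => U ∈ q)
      (ConcreteCategory.congr_hom s.h p).symm)
  exact ⟨spectralSpace_of_split (α := α) (t := t) hα hαt ht,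
    isFrameOrder_compactOpens_of_split (α := α) (t := t) hα hαt ht⟩

end SplitAlgebra

/-! ### From spectral spaces with a frame of compact opens to split algebras. -/

section SpectralFrame

open LatticeSpec

variable {X : Type u} [TopologicalSpace X] [SpectralSpace X]

/-- The point of a spectral space that has the same compact open neighbourhoods as a prime filter
of opens. -/
noncomputable def spectralLimit (p : LatticeSpec (Opens X)) : X :=
  (exists_forall_isCompact_mem_iff p).choose

theorem spectralLimit_mem_iff {p : LatticeSpec (Opens X)} {K : Opens X}
    (hK : IsCompact (K : Set X)) : spectralLimit p ∈ K ↔ K ∈ p :=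
  (exists_forall_isCompact_mem_iff p).choose_spec K hK

theorem eq_of_forall_isCompact_mem_iff {x y : X}
    (h : ∀ K : Opens X, IsCompact (K : Set X) → (x ∈ K ↔ y ∈ K)) : x = y := by
  refine ((PrespectralSpace.isTopologicalBasis (X := X)).inseparable_iff.2 ?_).eq
  rintro K ⟨hKo, hKc⟩
  exact h ⟨K, hKo⟩ hKc

theorem continuous_spectralLimit : Continuous (spectralLimit (X := X)) := by
  refine PrespectralSpace.isTopologicalBasis.continuous_iff.2 ?_
  rintro K ⟨hKo, hKc⟩
  have : spectralLimit ⁻¹' K = {p : LatticeSpec (Opens X) | (⟨K, hKo⟩ : Opens X) ∈ p} :=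
    Set.ext fun p => spectralLimit_mem_iff (K := ⟨K, hKo⟩) hKc
  rw [this]
  exact isOpen_setOf_mem _

/-- The algebra structure of a spectral space for the prime filter monad. -/
noncomputable def spectralAlgebra (X : Type u) [TopologicalSpace X] [SpectralSpace X] :
    primeFilterMonad.{u}.Algebra where
  A := TopCat.of X
  a := TopCat.ofHom ⟨spectralLimit, continuous_spectralLimit⟩
  unit := by
    ext x
    exact eq_of_forall_isCompact_mem_iff fun K hK => spectralLimit_mem_iff hK
  assoc := by
    ext P
    let Q : LatticeSpec (Opens (LatticeSpec (Opens X))) := P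
    refine eq_of_forall_isCompact_mem_iff (X := X) fun K hK => ?_
    refine (spectralLimit_mem_iff hK).trans (Iff.trans ?_ (spectralLimit_mem_iff hK).symm)
    -- For compact open `K`, the preimage of `K` under `spectralLimit` is `K^#`.
    refine iff_of_eq (congrArg (fun W : Opens (LatticeSpec (Opens X)) => W ∈ Q) ?_)
    exact Opens.ext (Set.ext fun p => (spectralLimit_mem_iff hK).symm)

theorem exists_isCompact_mem_subset {U : Opens X} {x : X} (hx : x ∈ U) :
    ∃ K : CompactOpens X, x ∈ K ∧ (K : Set X) ⊆ U := by
  obtain ⟨K, ⟨hKo, hKc⟩, hxK, hKU⟩ :=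
    PrespectralSpace.isTopologicalBasis.exists_subset_of_mem_open hx U.isOpen
  exact ⟨⟨⟨K, hKc⟩, hKo⟩, hxK, hKU⟩

/-- If the compact opens of a spectral space form a frame, then every open has a compact open hull,
and taking hulls is a lattice homomorphism. -/
theorem exists_compactOpenHull (h : IsFrameOrder (CompactOpens X)) :
    ∃ c : BoundedLatticeHom (Opens X) (Opens X), (∀ U, IsCompact (c U : Set X)) ∧ (∀ U, U ≤ c U) ∧
      ∀ K : Opens X, IsCompact (K : Set X) → c K = K := by
  rw [isFrameOrder_iff_of_semilatticeInf] at h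
  choose sup hlub hdist using h
  let c : Opens X → CompactOpens X := fun U => sup {K | (K : Set X) ⊆ U}
  have hle : ∀ U : Opens X, (U : Set X) ⊆ c U := fun U x hx => by
    obtain ⟨K, hxK, hKU⟩ := exists_isCompact_mem_subset hx
    exact (hlub _).1 hKU hxK
  have hmin : ∀ (U : Opens X) (K : CompactOpens X), (U : Set X) ⊆ K → c U ≤ K := fun U K hUK =>
    (hlub _).2 fun J hJ => Set.Subset.trans hJ hUK
  have hmono : ∀ {U V : Opens X}, U ≤ V → c U ≤ c V := fun {U V} hUV =>
    hmin _ _ ((SetLike.coe_subset_coe.2 hUV).trans (hle V))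
  have hinf : ∀ U V : Opens X, c U ⊓ c V ≤ c (U ⊓ V) := fun U V => by
    -- Distributing twice reduces to compact opens `K ⊆ V` and `J ⊆ U`, whose intersection is a
    -- compact open inside `U ⊓ V`.
    refine hdist _ _ _ fun K hK => ?_
    rw [inf_comm]
    refine hdist _ _ _ fun J hJ => ?_
    refine (hlub _).1 ?_
    exact fun x hx => ⟨hJ hx.2, hK hx.1⟩
  have hfix : ∀ K : CompactOpens X, c K.toOpens = K := fun K =>
    le_antisymm (hmin _ _ subset_rfl) (hle K.toOpens)
  refine ⟨{ toFun U := (c U).toOpens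
            map_sup' U V := le_antisymm
              (hmin (U ⊔ V) (c U ⊔ c V) (Set.union_subset_union (hle U) (hle V)))
              (sup_le (hmono le_sup_left) (hmono le_sup_right))
            map_inf' U V := le_antisymm
              (le_inf (hmono inf_le_left) (hmono inf_le_right)) (hinf U V)
            map_top' := top_le_iff.1 (hle ⊤)
            map_bot' := le_bot_iff.1 (hmin ⊥ ⊥ subset_rfl) },
    fun U => (c U).isCompact, hle, fun K hK => ?_⟩
  exact congrArg CompactOpens.toOpens (hfix ⟨⟨K, hK⟩, K.isOpen⟩)

/-- With `c` the hull, `x ↦ {U | x ∈ c U}` is a homomorphism because each `c U` is compact, and a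
section because `c` fixes compact opens. -/
theorem isSplitPrimeFilterAlgebra_of_isFrameOrder (h : IsFrameOrder (CompactOpens X)) :
    IsSplitPrimeFilterAlgebra X := by
  obtain ⟨c, hcomp, hle, hfix⟩ := exists_compactOpenHull h
  let t : C(X, LatticeSpec (Opens X)) := ⟨fun x => comap c (openNhdsFilter x), by
    refine continuous_generateFrom_iff.2 ?_
    rintro _ ⟨U, rfl⟩
    exact (c U).isOpen⟩
  refine ⟨spectralAlgebra X, rfl, ⟨TopCat.ofHom t, ?_⟩, ?_⟩
  · ext p
    let q : LatticeSpec (Opens X) := p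
    refine LatticeSpec.ext (L := Opens X) fun U => ?_
    exact (spectralLimit_mem_iff (p := q) (hcomp U)).symm
  · ext x
    refine eq_of_forall_isCompact_mem_iff (X := X) fun K hK => ?_
    refine (spectralLimit_mem_iff (p := t x) hK).trans ?_
    exact iff_of_eq (congrArg (fun U : Opens X => x ∈ U) (hfix K hK))

end SpectralFrame

theorem mainTheorem10 :
    (∀ (X : Type u) [TopologicalSpace X],
      IsSplitPrimeFilterAlgebra X ↔ SpectralSpace X ∧ IsFrameOrder (CompactOpens X)) ∧
    (∀ (L : Type u) [DistribLattice L] [BoundedOrder L],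
      (IsFrameOrder L ↔ IsSplitPrimeFilterAlgebra (LatticeSpec L)) ∧
      (IsFrameOrder L ↔ ∀ U : Set (LatticeSpec L), IsOpen U →
        IsOpen (@closure _ (constructibleTopology (LatticeSpec L)) U))) := by
  refine ⟨fun X _ => ⟨fun h => h.spectralSpace_and_isFrameOrder,
    fun ⟨_, h⟩ => isSplitPrimeFilterAlgebra_of_isFrameOrder h⟩, fun L _ _ => ⟨⟨fun h => ?_,
    fun h => ?_⟩, LatticeSpec.isFrameOrder_iff_isOpen_closure⟩⟩
  · exact isSplitPrimeFilterAlgebra_of_isFrameOrder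
      (h.of_orderIso (LatticeSpec.orderIsoCompactOpens L))
  · exact h.spectralSpace_and_isFrameOrder.2.of_orderIso (LatticeSpec.orderIsoCompactOpens L).symm
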